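/- Let $\mathbb F$ be an algebraically closed field with $\operatorname{char}\mathbb F\notin\{2,3,5\}$. Fix $i\in\mathbb F$ with $i^2=-1$ and, for every $x\in\mathbb F$, an element $\sqrt{x}\in\mathbb F$ with $(\sqrt x)^2=x$. An algebra over $\mathbb F$ is a vector space with a bilinear product (not assumed commutative, associative or unital); it is nontrivial if its product is not identically zero, and it is a Jordan algebra if $(u\cdot v)\cdot u^2=u\cdot(v\cdot u^2)$ for all $u,v$, where $u^2=u\cdot u$. Two algebras are isomorphic if there is an invertible linear map between them that preserves products. A matrix $M=\begin{pmatrix}\alpha_1&\alpha_2&\alpha_3&\alpha_4\\ \beta_1&\beta_2&\beta_3&\beta_4\end{pmatrix}$ over $\mathbb F$ stands for the algebra with basis $e_1,e_2$ and products $e_1e_1=\alpha_1e_1+\beta_1e_2$, $e_1e_2=\alpha_2e_1+\beta_2e_2$, $e_2e_1=\alpha_3e_1+\beta_3e_2$, $e_2e_2=\alpha_4e_1+\beta_4e_2$. Then every algebra in the following list is a nontrivial $2$-dimensional Jordan algebra, and every nontrivial $2$-dimensional Jordan algebra over $\mathbb F$ is isomorphic to exactly one algebra in the list (where algebras with different labels,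 or with the same label and different parameters $\alpha$, count as different): - $J_1=\begin{pmatrix}\frac12&0&0&1\\0&\frac12&\frac12&0\end{pmatrix}$, $\quad J_2=\begin{pmatrix}\frac12&0&0&1\\0&-\frac12&\frac12&0\end{pmatrix}$; - $J_3(\alpha)=\begin{pmatrix}\alpha&0&0&0\\0&-1+2\alpha&-\alpha+1&0\end{pmatrix}$, where $\alpha\in\mathbb F$ and $\alpha\ne\frac1{10}(5\pm\sqrt5)$; - $J_4(\alpha)=\begin{pmatrix}\alpha&0&0&0\\0&\sqrt{\alpha-\alpha^2}&-\alpha+1&0\end{pmatrix}$, where $\alpha\in\mathbb F$; - $J_5(\alpha)=\begin{pmatrix}\alpha&0&0&0\\0&-\sqrt{\alpha-\alpha^2}&-\alpha+1&0\end{pmatrix}$, where $\alpha\in\mathbb F$ and $\alpha\ne0,1$; - $J_6=\begin{pmatrix}\frac1{10}(5-\sqrt5)&0&0&0\\1&-\frac{\sqrt5}5&\frac1{10}(5+\sqrt5)&0\end{pmatrix}$, $\quad J_7=\begin{pmatrix}\frac1{10}(5+\sqrt5)&0&0&0\\1&\frac{\sqrt5}5&\frac1{10}(5-\sqrt5)&0\end{pmatrix}$;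 - $J_8=\begin{pmatrix}\frac13&0&0&0\\0&\frac23&-\frac13&0\end{pmatrix}$; - $J_9=\begin{pmatrix}\frac12-\frac i2&0&0&0\\0&\frac12+\frac i2&-\frac12+\frac i2&0\end{pmatrix}$, $\quad J_{10}=\begin{pmatrix}\frac12+\frac i2&0&0&0\\0&\frac12-\frac i2&-\frac12-\frac i2&0\end{pmatrix}$; - $J_{11}=\begin{pmatrix}0&0&0&0\\1&0&0&0\end{pmatrix}$. -/

import Mathlib

/-- The (not necessarily commutative, associative or unital) algebra `A` satisfies the Jordan
identity `(u · v) · u² = u · (v · u²)`. -/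
def IsJordanAlgebra (A : Type*) [Mul A] : Prop :=
  ∀ u v : A, (u * v) * (u * u) = u * (v * (u * u))

/-- The multiplication of `A` is not identically zero. -/
def IsNontrivialAlgebra (A : Type*) [Mul A] [Zero A] : Prop :=
  ∃ u v : A, u * v ≠ 0

/-- Isomorphism of algebras over `F`: an invertible linear map that preserves products. -/
def AlgebraIsomorphic (F : Type*) [Field F] (A B : Type*)
    [NonUnitalNonAssocRing A] [Module F A] [NonUnitalNonAssocRing B] [Module F B] : Prop :=
  ∃ f : A ≃ₗ[F] B, ∀ u v : A, f (u * v) = f u * f v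

/-- Coordinates of `u ⊗ v` (Kronecker product of column vectors of length two). -/
def kron2 {F : Type*} [Field F] (u v : Fin 2 → F) : Fin 4 → F :=
  ![u 0 * v 0, u 0 * v 1, u 1 * v 0, u 1 * v 1]

/-- The two-dimensional algebra on `F²` whose matrix of structure constants with respect to the
standard basis is `M`; its product is `u · v = M (u ⊗ v)`. -/
def MSCAlgebra {F : Type*} (_M : Matrix (Fin 2) (Fin 4) F) : Type _ := Fin 2 → F

namespace MSCAlgebra

instance instAddCommGroup {F : Type*} [Field F] (M : Matrix (Fin 2) (Fin 4) F) :
    AddCommGroup (MSCAlgebra M) :=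
  inferInstanceAs (AddCommGroup (Fin 2 → F))

instance instModule {F : Type*} [Field F] (M : Matrix (Fin 2) (Fin 4) F) :
    Module F (MSCAlgebra M) :=
  inferInstanceAs (Module F (Fin 2 → F))

instance instMul {F : Type*} [Field F] (M : Matrix (Fin 2) (Fin 4) F) : Mul (MSCAlgebra M) :=
  ⟨fun u v => M.mulVec (kron2 u v)⟩

theorem mul_apply {F : Type*} [Field F] (M : Matrix (Fin 2) (Fin 4) F) (u v : MSCAlgebra M)
    (k : Fin 2) :
    (u * v) k = M k 0 * (u 0 * v 0) + M k 1 * (u 0 * v 1) + M k 2 * (u 1 * v 0)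
      + M k 3 * (u 1 * v 1) := by
  change M.mulVec (kron2 u v) k = _
  simp [Matrix.mulVec, dotProduct, kron2, Fin.sum_univ_four]

theorem add_apply {F : Type*} [Field F] (M : Matrix (Fin 2) (Fin 4) F) (u v : MSCAlgebra M)
    (k : Fin 2) : (u + v) k = u k + v k := rfl

theorem zero_apply {F : Type*} [Field F] (M : Matrix (Fin 2) (Fin 4) F)
    (k : Fin 2) : (0 : MSCAlgebra M) k = 0 := rfl

theorem smul_apply {F : Type*} [Field F] (M : Matrix (Fin 2) (Fin 4) F) (c : F)
    (u : MSCAlgebra M) (k : Fin 2) : (c • u) k = c * u k := rfl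

instance instRing {F : Type*} [Field F] (M : Matrix (Fin 2) (Fin 4) F) :
    NonUnitalNonAssocRing (MSCAlgebra M) :=
  { instAddCommGroup M, instMul M with
    left_distrib := by
      intro a b c
      funext k
      simp only [mul_apply, add_apply]
      ring
    right_distrib := by
      intro a b c
      funext k
      simp only [mul_apply, add_apply]
      ring
    zero_mul := by
      intro a
      funext k
      simp only [mul_apply, zero_apply]
      ring
    mul_zero := by
      intro a
      funext k
      simp only [mul_apply, zero_apply]
      ring }

instance instIsScalarTower {F : Type*} [Field F] (M : Matrix (Fin 2) (Fin 4) F) :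
    IsScalarTower F (MSCAlgebra M) (MSCAlgebra M) :=
  ⟨by
    intro c u v
    funext k
    simp only [smul_eq_mul, mul_apply, smul_apply]
    ring⟩

instance instSMulCommClass {F : Type*} [Field F] (M : Matrix (Fin 2) (Fin 4) F) :
    SMulCommClass F (MSCAlgebra M) (MSCAlgebra M) :=
  ⟨by
    intro c u v
    funext k
    simp only [smul_eq_mul, mul_apply, smul_apply]
    ring⟩

end MSCAlgebra

/-- Labels of the members of the list; the three families carry their parameter. -/
inductive JordanLabel (F : Type*) where
  | J1 : JordanLabel F
  | J2 : JordanLabel F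
  | J3 : F → JordanLabel F
  | J4 : F → JordanLabel F
  | J5 : F → JordanLabel F
  | J6 : JordanLabel F
  | J7 : JordanLabel F
  | J8 : JordanLabel F
  | J9 : JordanLabel F
  | J10 : JordanLabel F
  | J11 : JordanLabel F

/-- The restrictions on the parameters of the families; `s` is the chosen square root function. -/
def JordanLabel.Admissible {F : Type*} [Field F] (s : F → F) : JordanLabel F → Prop
  | .J3 a => a ≠ 1 / 10 * (5 + s 5) ∧ a ≠ 1 / 10 * (5 - s 5)
  | .J5 a => a ≠ 0 ∧ a ≠ 1
  | _ => True

/-- The matrices of structure constants; `s` is the chosen square root function and `i` the chosen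
square root of `-1`. -/
def JordanLabel.msc {F : Type*} [Field F] (s : F → F) (i : F) :
    JordanLabel F → Matrix (Fin 2) (Fin 4) F
  | .J1 => !![1 / 2, 0, 0, 1;
              0, 1 / 2, 1 / 2, 0]
  | .J2 => !![1 / 2, 0, 0, 1;
              0, -(1 / 2), 1 / 2, 0]
  | .J3 a => !![a, 0, 0, 0;
                0, -1 + 2 * a, -a + 1, 0]
  | .J4 a => !![a, 0, 0, 0;
                0, s (a - a ^ 2), -a + 1, 0]
  | .J5 a => !![a, 0, 0, 0;
                0, -s (a - a ^ 2), -a + 1, 0]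
  | .J6 => !![1 / 10 * (5 - s 5), 0, 0, 0;
              1, -(s 5 / 5), 1 / 10 * (5 + s 5), 0]
  | .J7 => !![1 / 10 * (5 + s 5), 0, 0, 0;
              1, s 5 / 5, 1 / 10 * (5 - s 5), 0]
  | .J8 => !![1 / 3, 0, 0, 0;
              0, 2 / 3, -(1 / 3), 0]
  | .J9 => !![1 / 2 - i / 2, 0, 0, 0;
              0, 1 / 2 + i / 2, -(1 / 2) + i / 2, 0]
  | .J10 => !![1 / 2 + i / 2, 0, 0, 0;
               0, 1 / 2 - i / 2, -(1 / 2) - i / 2, 0]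
  | .J11 => !![0, 0, 0, 0;
               1, 0, 0, 0]

/-! In an algebra with basis e₁, e₂ the traces of right and of left multiplication by u are linear
forms in u, independent of the basis. A nonzero trace form picks out almost all of a basis: e₂ spans
its kernel and e₁ has value 1, which leaves only the shears e₁ ↦ e₁ + k e₂, e₂ ↦ t e₂. The Jordan
identity on a few vectors then leaves few structure constants.

If the right trace is nonzero, either e₂e₂ = e₁ can be arranged, giving J1 and J2, or the matrix is
triangular and `isJordanAlgebra_triangular_iff` gives J3 to J7. If only the left trace is nonzero,
the matrix is triangular and gives J8, J9, J10. If both vanish, a nonzero algebra has a basis u, u²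
and is J11.

For uniqueness, an isomorphism between normalized algebras must itself be a shear, so
`IsBasisChange.invariants` separates the labels. -/

/-! ### Isomorphism as change of basis, and the trace forms. -/

section BasisChange

variable {F : Type*} [Field F]

/-- The vectors `x e₁ + y e₂` and `z e₁ + w e₂` form a basis of `MSCAlgebra N`, and the matrix of
structure constants in this basis is `M`. -/
def IsBasisChange (M N : Matrix (Fin 2) (Fin 4) F) (x y z w : F) : Prop :=
  x * w - y * z ≠ 0 ∧
  N 0 0 * (x * x) + N 0 1 * (x * y) + N 0 2 * (y * x) + N 0 3 * (y * y)
    = M 0 0 * x + M 1 0 * z ∧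
  N 1 0 * (x * x) + N 1 1 * (x * y) + N 1 2 * (y * x) + N 1 3 * (y * y)
    = M 0 0 * y + M 1 0 * w ∧
  N 0 0 * (x * z) + N 0 1 * (x * w) + N 0 2 * (y * z) + N 0 3 * (y * w)
    = M 0 1 * x + M 1 1 * z ∧
  N 1 0 * (x * z) + N 1 1 * (x * w) + N 1 2 * (y * z) + N 1 3 * (y * w)
    = M 0 1 * y + M 1 1 * w ∧
  N 0 0 * (z * x) + N 0 1 * (z * y) + N 0 2 * (w * x) + N 0 3 * (w * y)
    = M 0 2 * x + M 1 2 * z ∧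
  N 1 0 * (z * x) + N 1 1 * (z * y) + N 1 2 * (w * x) + N 1 3 * (w * y)
    = M 0 2 * y + M 1 2 * w ∧
  N 0 0 * (z * z) + N 0 1 * (z * w) + N 0 2 * (w * z) + N 0 3 * (w * w)
    = M 0 3 * x + M 1 3 * z ∧
  N 1 0 * (z * z) + N 1 1 * (z * w) + N 1 2 * (w * z) + N 1 3 * (w * w)
    = M 0 3 * y + M 1 3 * w

theorem AlgebraIsomorphic.symm {A B : Type*} [NonUnitalNonAssocRing A] [Module F A]
    [NonUnitalNonAssocRing B] [Module F B] (h : AlgebraIsomorphic F A B) :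
    AlgebraIsomorphic F B A := by
  obtain ⟨f, hf⟩ := h
  exact ⟨f.symm, fun u v => f.injective (by simp [hf])⟩

theorem AlgebraIsomorphic.trans {A B C : Type*} [NonUnitalNonAssocRing A] [Module F A]
    [NonUnitalNonAssocRing B] [Module F B] [NonUnitalNonAssocRing C] [Module F C]
    (h : AlgebraIsomorphic F A B) (h' : AlgebraIsomorphic F B C) : AlgebraIsomorphic F A C := by
  obtain ⟨f, hf⟩ := h
  obtain ⟨g, hg⟩ := h'
  exact ⟨f.trans g, fun u v => by simp [hf, hg]⟩

theorem AlgebraIsomorphic.isJordanAlgebra {A B : Type*} [NonUnitalNonAssocRing A] [Module F A]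
    [NonUnitalNonAssocRing B] [Module F B] (h : AlgebraIsomorphic F A B)
    (hA : IsJordanAlgebra A) : IsJordanAlgebra B := by
  obtain ⟨f, hf⟩ := h.symm
  exact fun u v => f.injective (by simp only [hf]; exact hA _ _)

theorem AlgebraIsomorphic.isNontrivialAlgebra {A B : Type*} [NonUnitalNonAssocRing A] [Module F A]
    [NonUnitalNonAssocRing B] [Module F B] (h : AlgebraIsomorphic F A B)
    (hA : IsNontrivialAlgebra A) : IsNontrivialAlgebra B := by
  obtain ⟨f, hf⟩ := h
  obtain ⟨u, v, huv⟩ := hA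
  exact ⟨f u, f v, by rw [← hf]; simpa using huv⟩

theorem MSCAlgebra.ext {K : Type*} {M : Matrix (Fin 2) (Fin 4) K} {u v : MSCAlgebra M}
    (h0 : u 0 = v 0) (h1 : u 1 = v 1) : u = v := by
  funext k
  fin_cases k
  · exact h0
  · exact h1

theorem IsBasisChange.algebraIsomorphic {M N : Matrix (Fin 2) (Fin 4) F} {x y z w : F}
    (h : IsBasisChange M N x y z w) : AlgebraIsomorphic F (MSCAlgebra M) (MSCAlgebra N) := by
  obtain ⟨hD, h1, h2, h3, h4, h5, h6, h7, h8⟩ := h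
  let P : Matrix (Fin 2) (Fin 2) F := !![x, z; y, w]
  have hP : IsUnit P.det := by
    rw [Matrix.det_fin_two_of, isUnit_iff_ne_zero]
    convert hD using 1
    ring
  let f : (Fin 2 → F) ≃ₗ[F] (Fin 2 → F) := Matrix.toLinearEquiv' P (P.invertibleOfIsUnitDet hP)
  have hf (u : Fin 2 → F) : f u 0 = x * u 0 + z * u 1 ∧ f u 1 = y * u 0 + w * u 1 := by
    simp [f, P, Matrix.toLinearEquiv', Matrix.mulVec, dotProduct]
  let f' : MSCAlgebra M ≃ₗ[F] MSCAlgebra N := f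
  have hf0 (u : MSCAlgebra M) : f' u 0 = x * u 0 + z * u 1 := (hf u).1
  have hf1 (u : MSCAlgebra M) : f' u 1 = y * u 0 + w * u 1 := (hf u).2
  refine ⟨f', fun u v => MSCAlgebra.ext ?_ ?_⟩
  · simp only [hf0, hf1, MSCAlgebra.mul_apply]
    linear_combination (-(u 0 * v 0)) * h1 - u 0 * v 1 * h3 - u 1 * v 0 * h5 - u 1 * v 1 * h7
  · simp only [hf0, hf1, MSCAlgebra.mul_apply]
    linear_combination (-(u 0 * v 0)) * h2 - u 0 * v 1 * h4 - u 1 * v 0 * h6 - u 1 * v 1 * h8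

theorem AlgebraIsomorphic.exists_isBasisChange {M N : Matrix (Fin 2) (Fin 4) F}
    (h : AlgebraIsomorphic F (MSCAlgebra M) (MSCAlgebra N)) :
    ∃ x y z w : F, IsBasisChange M N x y z w := by
  obtain ⟨f, hf⟩ := h
  let e₁ : MSCAlgebra M := (![1, 0] : Fin 2 → F)
  let e₂ : MSCAlgebra M := (![0, 1] : Fin 2 → F)
  have e10 : e₁ 0 = 1 := rfl
  have e11 : e₁ 1 = 0 := rfl
  have e20 : e₂ 0 = 0 := rfl
  have e21 : e₂ 1 = 1 := rfl
  have hlin (u : MSCAlgebra M) : f u = u 0 • f e₁ + u 1 • f e₂ := by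
    rw [← map_smul, ← map_smul, ← map_add]
    congr 1
    apply MSCAlgebra.ext <;>
      simp [MSCAlgebra.add_apply, MSCAlgebra.smul_apply, e10, e11, e20, e21]
  have key (u v : MSCAlgebra M) (k : Fin 2) := congrFun (hf u v) k
  simp only [hlin (_ * _), MSCAlgebra.add_apply, MSCAlgebra.smul_apply,
    MSCAlgebra.mul_apply] at key
  refine ⟨f e₁ 0, f e₁ 1, f e₂ 0, f e₂ 1, ?_, ?_⟩
  · intro hD
    have hinj (r t : F) (h0 : r * f e₁ 0 + t * f e₂ 0 = 0) (h1 : r * f e₁ 1 + t * f e₂ 1 = 0) :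
        r = 0 ∧ t = 0 := by
      let u : MSCAlgebra M := (![r, t] : Fin 2 → F)
      have hu : f u = 0 := by
        rw [hlin]
        exact MSCAlgebra.ext h0 h1
      have hu' : u = 0 := by simpa using hu
      exact ⟨congrFun hu' 0, congrFun hu' 1⟩
    -- A vanishing determinant makes the rows of the adjugate linear relations between the images;
    -- injectivity makes all their entries zero, so `f e₁ = 0`.
    have h1 := hinj (f e₂ 1) (-f e₁ 1) (by linear_combination hD) (by ring)
    have h2 := hinj (f e₂ 0) (-f e₁ 0) (by ring) (by linear_combination -hD)
    have h3 := hinj 1 0 (by linear_combination -h2.2) (by linear_combination -h1.2)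
    exact one_ne_zero h3.1
  · have k1 := key e₁ e₁
    have k2 := key e₁ e₂
    have k3 := key e₂ e₁
    have k4 := key e₂ e₂
    simp only [e10, e11, e20, e21] at k1 k2 k3 k4
    refine ⟨?_, ?_, ?_, ?_, ?_, ?_, ?_, ?_⟩
    · linear_combination -k1 0
    · linear_combination -k1 1
    · linear_combination -k2 0
    · linear_combination -k2 1
    · linear_combination -k3 0
    · linear_combination -k3 1
    · linear_combination -k4 0
    · linear_combination -k4 1

/-- The two sums are the values on the basis of the linear form u ↦ tr(v ↦ v u), so they transform
as a covector. `IsBasisChange.traceL` is the same for v ↦ u v. -/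
theorem IsBasisChange.traceR {M N : Matrix (Fin 2) (Fin 4) F} {x y z w : F}
    (h : IsBasisChange M N x y z w) :
    M 0 0 + M 1 2 = x * (N 0 0 + N 1 2) + y * (N 0 1 + N 1 3) ∧
    M 0 1 + M 1 3 = z * (N 0 0 + N 1 2) + w * (N 0 1 + N 1 3) := by
  obtain ⟨hD, h1, h2, h3, h4, h5, h6, h7, h8⟩ := h
  constructor
  · apply mul_left_cancel₀ hD
    linear_combination -w * h1 + z * h2 - x * h6 + y * h5
  · apply mul_left_cancel₀ hD
    linear_combination -w * h3 + z * h4 - x * h8 + y * h7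

theorem IsBasisChange.traceL {M N : Matrix (Fin 2) (Fin 4) F} {x y z w : F}
    (h : IsBasisChange M N x y z w) :
    M 0 0 + M 1 1 = x * (N 0 0 + N 1 1) + y * (N 0 2 + N 1 3) ∧
    M 0 2 + M 1 3 = z * (N 0 0 + N 1 1) + w * (N 0 2 + N 1 3) := by
  obtain ⟨hD, h1, h2, h3, h4, h5, h6, h7, h8⟩ := h
  constructor
  · apply mul_left_cancel₀ hD
    linear_combination -w * h1 + z * h2 - x * h4 + y * h3
  · apply mul_left_cancel₀ hD
    linear_combination -w * h5 + z * h6 - x * h8 + y * h7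

theorem exists_isBasisChange (N : Matrix (Fin 2) (Fin 4) F) {x y z w : F}
    (hD : x * w - y * z ≠ 0) : ∃ M, IsBasisChange M N x y z w := by
  let E (k : Fin 2) (a b c d : F) : F :=
    N k 0 * (a * c) + N k 1 * (a * d) + N k 2 * (b * c) + N k 3 * (b * d)
  -- Cramer's rule: `A` and `B` are the coordinates of a product in the new basis.
  let A (a b c d : F) : F := (w * E 0 a b c d - z * E 1 a b c d) / (x * w - y * z)
  let B (a b c d : F) : F := (x * E 1 a b c d - y * E 0 a b c d) / (x * w - y * z)
  have h0 (a b c d : F) : E 0 a b c d = A a b c d * x + B a b c d * z := by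
    simp only [A, B]; rw [div_mul_eq_mul_div, div_mul_eq_mul_div, ← add_div, eq_div_iff hD]; ring
  have h1 (a b c d : F) : E 1 a b c d = A a b c d * y + B a b c d * w := by
    simp only [A, B]; rw [div_mul_eq_mul_div, div_mul_eq_mul_div, ← add_div, eq_div_iff hD]; ring
  exact ⟨!![A x y x y, A x y z w, A z w x y, A z w z w;
    B x y x y, B x y z w, B z w x y, B z w z w], hD, h0 _ _ _ _, h1 _ _ _ _, h0 _ _ _ _,
    h1 _ _ _ _, h0 _ _ _ _, h1 _ _ _ _, h0 _ _ _ _, h1 _ _ _ _⟩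

theorem exists_algebraIsomorphic_MSCAlgebra {A : Type*} [NonUnitalNonAssocRing A] [Module F A]
    [IsScalarTower F A A] [SMulCommClass F A A] (hA : Module.finrank F A = 2) :
    ∃ M : Matrix (Fin 2) (Fin 4) F, AlgebraIsomorphic F A (MSCAlgebra M) := by
  have : Module.Finite F A := Module.finite_of_finrank_eq_succ hA
  let b : Module.Basis (Fin 2) F A := Module.finBasisOfFinrankEq F A hA
  let T (i j k : Fin 2) : F := b.repr (b i * b j) k
  let M : Matrix (Fin 2) (Fin 4) F :=
    !![T 0 0 0, T 0 1 0, T 1 0 0, T 1 1 0; T 0 0 1, T 0 1 1, T 1 0 1, T 1 1 1]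
  let f : A ≃ₗ[F] MSCAlgebra M := b.equivFun
  have hf (u : A) (k : Fin 2) : f u k = b.repr u k := rfl
  refine ⟨M, f, fun u v => ?_⟩
  have hmul (k : Fin 2) : b.repr (u * v) k = T 0 0 k * (b.repr u 0 * b.repr v 0)
      + T 0 1 k * (b.repr u 0 * b.repr v 1) + T 1 0 k * (b.repr u 1 * b.repr v 0)
      + T 1 1 k * (b.repr u 1 * b.repr v 1) := by
    conv_lhs => rw [← b.sum_repr u, ← b.sum_repr v]
    simp only [Fin.sum_univ_two, add_mul, mul_add, smul_mul_assoc, mul_smul_comm, map_add,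
      map_smul, Finsupp.add_apply, Finsupp.smul_apply, smul_eq_mul, T]
    ring
  apply MSCAlgebra.ext <;> simp only [MSCAlgebra.mul_apply, hf, hmul] <;> rfl

end BasisChange

/-! ### Consequences of the Jordan identity for normalized structure constants. -/

section Jordan

variable {F : Type*} [Field F]

/-- The product of `MSCAlgebra M` in coordinates. -/
def mscMul (M : Matrix (Fin 2) (Fin 4) F) (u v : F × F) : F × F :=
  (M 0 0 * (u.1 * v.1) + M 0 1 * (u.1 * v.2) + M 0 2 * (u.2 * v.1) + M 0 3 * (u.2 * v.2),
    M 1 0 * (u.1 * v.1) + M 1 1 * (u.1 * v.2) + M 1 2 * (u.2 * v.1) + M 1 3 * (u.2 * v.2))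

theorem isJordanAlgebra_iff {M : Matrix (Fin 2) (Fin 4) F} :
    IsJordanAlgebra (MSCAlgebra M) ↔ ∀ x y z w : F,
      mscMul M (mscMul M (x, y) (z, w)) (mscMul M (x, y) (x, y)) =
        mscMul M (x, y) (mscMul M (z, w) (mscMul M (x, y) (x, y))) := by
  constructor
  · intro h x y z w
    let u : MSCAlgebra M := (![x, y] : Fin 2 → F)
    let v : MSCAlgebra M := (![z, w] : Fin 2 → F)
    have u0 : u 0 = x := rfl
    have u1 : u 1 = y := rfl
    have v0 : v 0 = z := rfl
    have v1 : v 1 = w := rfl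
    have h0 := congrFun (h u v) 0
    have h1 := congrFun (h u v) 1
    simp only [MSCAlgebra.mul_apply, u0, u1, v0, v1] at h0 h1
    exact Prod.ext h0 h1
  · intro h u v
    have h' := h (u 0) (u 1) (v 0) (v 1)
    apply MSCAlgebra.ext
    · simp only [MSCAlgebra.mul_apply]
      exact congrArg Prod.fst h'
    · simp only [MSCAlgebra.mul_apply]
      exact congrArg Prod.snd h'

theorem isNontrivialAlgebra_iff {M : Matrix (Fin 2) (Fin 4) F} :
    IsNontrivialAlgebra (MSCAlgebra M) ↔ M ≠ 0 := by
  constructor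
  · rintro ⟨u, v, huv⟩ rfl
    exact huv (MSCAlgebra.ext (by simp [MSCAlgebra.mul_apply, MSCAlgebra.zero_apply])
      (by simp [MSCAlgebra.mul_apply, MSCAlgebra.zero_apply]))
  · intro hM
    by_contra h
    simp only [IsNontrivialAlgebra, not_exists, not_not] at h
    apply hM
    let e₁ : MSCAlgebra M := (![1, 0] : Fin 2 → F)
    let e₂ : MSCAlgebra M := (![0, 1] : Fin 2 → F)
    have e10 : e₁ 0 = 1 := rfl
    have e11 : e₁ 1 = 0 := rfl
    have e20 : e₂ 0 = 0 := rfl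
    have e21 : e₂ 1 = 1 := rfl
    have key (u v : MSCAlgebra M) (k : Fin 2) := congrFun (h u v) k
    simp only [MSCAlgebra.mul_apply] at key
    ext k l
    have k1 := key e₁ e₁ k
    have k2 := key e₁ e₂ k
    have k3 := key e₂ e₁ k
    have k4 := key e₂ e₂ k
    simp only [e10, e11, e20, e21, mul_one, mul_zero, add_zero, zero_add] at k1 k2 k3 k4
    fin_cases l
    · exact k1
    · exact k2
    · exact k3
    · exact k4

/-- The e₁-coordinate of the identity is automatic. In the e₂-coordinate the only monomials that
survive are x³z and x²yz, and their coefficients give the two conditions. -/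
theorem isJordanAlgebra_triangular_iff (a b c d : F) :
    IsJordanAlgebra (MSCAlgebra !![a, 0, 0, 0; d, b, c, 0]) ↔
      d * (b ^ 2 - a * c) = 0 ∧ (b ^ 2 - a * c) * (a - b - c) = 0 := by
  rw [isJordanAlgebra_iff]
  constructor
  · intro h
    have h1 := congrArg Prod.snd (h 1 0 1 0)
    have h2 := congrArg Prod.snd (h 1 1 1 0)
    simp [mscMul] at h1 h2
    constructor
    · linear_combination -h1
    · linear_combination h2 - h1
  · rintro ⟨h1, h2⟩ x y z w
    ext
    · simp [mscMul]; left; ring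
    · simp [mscMul]
      linear_combination -x ^ 3 * z * h1 + x ^ 2 * y * z * h2

/-- Structure constants after replacing `e₁, e₂` by `e₁ + k e₂, t e₂`. -/
theorem algebraIsomorphic_shear {a p q g d b c h a' p' q' g' d' b' c' h' : F} (k : F) {t : F}
    (ht : t ≠ 0) (ha : a' = a + k * (p + q) + k ^ 2 * g) (hp : p' = t * (p + k * g))
    (hq : q' = t * (q + k * g)) (hg : g' = t ^ 2 * g)
    (hd : d' = (d + k * (b + c - a) + k ^ 2 * (h - p - q) - k ^ 3 * g) / t)
    (hb : b' = b + k * h - k * (p + k * g)) (hc : c' = c + k * h - k * (q + k * g))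
    (hh : h' = t * (h - k * g)) :
    AlgebraIsomorphic F (MSCAlgebra !![a, p, q, g; d, b, c, h])
      (MSCAlgebra !![a', p', q', g'; d', b', c', h']) := by
  subst ha hp hq hg hd hb hc hh
  apply AlgebraIsomorphic.symm
  refine IsBasisChange.algebraIsomorphic (x := 1) (y := k) (z := 0) (w := t) ?_
  refine ⟨by simpa using ht, ?_, ?_, ?_, ?_, ?_, ?_, ?_, ?_⟩ <;> simp <;> field_simp <;> ring

theorem jordan_of_square_eq_traceR_one (h2 : (2 : F) ≠ 0) {a q d b c : F}
    (hJ : IsJordanAlgebra (MSCAlgebra !![a, 0, q, 1; d, b, c, 0])) (hac : a + c = 1) :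
    q = 0 ∧ d = 0 ∧ a = 1 / 2 ∧ c = 1 / 2 ∧ (b = 1 / 2 ∨ b = -(1 / 2)) := by
  rw [isJordanAlgebra_iff] at hJ
  have e1 := congrArg Prod.fst (hJ 0 1 0 1)
  have e2 := congrArg Prod.snd (hJ 0 1 0 1)
  have e3 := congrArg Prod.fst (hJ 1 0 0 1)
  have e4 := congrArg Prod.snd (hJ 1 0 0 1)
  have e5 := congrArg Prod.fst (hJ 1 1 1 0)
  simp [mscMul] at e1 e2 e3 e4 e5
  have hq : q = 0 := by
    by_contra hq
    grind
  subst hq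
  have hc : c = 1 / 2 := by grind
  have ha : a = 1 / 2 := by grind
  refine ⟨rfl, by grind, ha, hc, ?_⟩
  grind

/-- Excludes an idempotent e₂ in the kernel of the right trace: the identity forces c = d = 0 and q
= -1, and then 4 = 0. -/
theorem not_isJordanAlgebra_of_traceR_one (h2 : (2 : F) ≠ 0) {a q d c : F} (hac : a + c = 1) :
    ¬ IsJordanAlgebra (MSCAlgebra !![a, -1, q, 0; d, 0, c, 1]) := by
  intro hJ
  rw [isJordanAlgebra_iff] at hJ
  have e1 := congrArg Prod.snd (hJ 0 1 1 0)
  have e2 := congrArg Prod.fst (hJ 1 0 0 1)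
  have e3 := congrArg Prod.snd (hJ 1 0 0 1)
  have e4 := congrArg Prod.fst (hJ 1 1 0 1)
  have e5 := congrArg Prod.fst (hJ 1 (-1) 0 1)
  simp [mscMul] at e1 e2 e3 e4 e5
  have hc : c = 0 := by grind
  subst hc
  have hd : d = 0 := by grind
  have hq : q = -1 := by grind
  subst hd hq
  have h4 : (2 : F) * 2 = 0 := by grind
  exact mul_ne_zero h2 h2 h4

/-- Once q vanishes, the line of e₂ is a two-sided ideal and the matrix is triangular. -/
theorem jordan_of_square_zero_traceR_one (h2 : (2 : F) ≠ 0) {a q d b c : F}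
    (hJ : IsJordanAlgebra (MSCAlgebra !![a, 0, q, 0; d, b, c, 0])) : q = 0 := by
  rw [isJordanAlgebra_iff] at hJ
  have e2 := congrArg Prod.fst (hJ 1 1 0 1)
  have e3 := congrArg Prod.fst (hJ 1 (-1) 0 1)
  have e1 := congrArg Prod.fst (hJ 1 0 0 1)
  simp [mscMul] at e1 e2 e3
  grind

theorem not_isJordanAlgebra_of_square_eq_traceR_zero {a d b : F}
    (hab : a + b = 1) : ¬ IsJordanAlgebra (MSCAlgebra !![a, 0, 0, 1; d, b, -a, 0]) := by
  intro hJ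
  rw [isJordanAlgebra_iff] at hJ
  have e1 := congrArg Prod.fst (hJ 0 1 0 1)
  have e2 := congrArg Prod.snd (hJ 0 1 0 1)
  have e3 := congrArg Prod.fst (hJ 1 1 1 0)
  simp [mscMul] at e1 e2 e3
  grind

theorem eq_zero_of_isJordanAlgebra_traceR_zero (h2 : (2 : F) ≠ 0) {a d b h : F}
    (hJ : IsJordanAlgebra (MSCAlgebra !![a, -h, -h, 0; d, b, -a, h])) (hab : a + b = 1) :
    h = 0 := by
  rw [isJordanAlgebra_iff] at hJ
  have e1 := congrArg Prod.snd (hJ 0 1 1 0)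
  simp [mscMul] at e1
  have hh : 2 * (h * h) = 0 := by grind
  simpa [h2] using hh

/-- At u = v = e₁ the identity reads e₂e₂ = e₁(e₁e₂), that is, g e₁ - p e₂ = p e₂. -/
theorem eq_zero_of_isJordanAlgebra_traceless (h2 : (2 : F) ≠ 0) {p g : F}
    (hJ : IsJordanAlgebra (MSCAlgebra !![0, p, p, g; 1, 0, 0, -p])) : p = 0 ∧ g = 0 := by
  rw [isJordanAlgebra_iff] at hJ
  have e1 := congrArg Prod.snd (hJ 1 0 1 0)
  have e2 := congrArg Prod.fst (hJ 1 0 1 0)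
  simp [mscMul] at e1 e2
  grind

end Jordan

/-! ### Reduction of each Jordan algebra to a normal form. -/

section Existence

variable {F : Type*} [Field F]

/-- A shear moves d by multiples of b + c - a, so d can be cleared unless b + c = a; in that case it
can only be rescaled. -/
theorem algebraIsomorphic_triangular {a d d' b c : F} (k : F) {t : F} (ht : t ≠ 0)
    (hd : d' * t = d + k * (b + c - a)) :
    AlgebraIsomorphic F (MSCAlgebra !![a, 0, 0, 0; d, b, c, 0])
      (MSCAlgebra !![a, 0, 0, 0; d', b, c, 0]) :=
  algebraIsomorphic_shear k ht (by ring) (by ring) (by ring) (by ring)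
    (by rw [eq_div_iff ht]; linear_combination hd) (by ring) (by ring) (by ring)

/-- Some admissible label has an algebra isomorphic to `MSCAlgebra M`. -/
def HasLabel (s : F → F) (i : F) (M : Matrix (Fin 2) (Fin 4) F) : Prop :=
  ∃ j : JordanLabel F, j.Admissible s ∧ AlgebraIsomorphic F (MSCAlgebra M) (MSCAlgebra (j.msc s i))

variable {s : F → F} {i : F}

theorem HasLabel.of_eq {M : Matrix (Fin 2) (Fin 4) F} (j : JordanLabel F)
    (hj : j.Admissible s) (h : M = j.msc s i) : HasLabel s i M :=
  ⟨j, hj, h ▸ ⟨LinearEquiv.refl _ _, fun _ _ => rfl⟩⟩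

theorem HasLabel.of_iso {M N : Matrix (Fin 2) (Fin 4) F}
    (h : AlgebraIsomorphic F (MSCAlgebra M) (MSCAlgebra N)) (hN : HasLabel s i N) :
    HasLabel s i M := by
  obtain ⟨j, hj, hj'⟩ := hN
  exact ⟨j, hj, h.trans hj'⟩

theorem HasLabel.of_sq_eq (hs : ∀ x : F, s x ^ 2 = x) {a b : F} (hb : b ^ 2 = a - a ^ 2) :
    HasLabel s i !![a, 0, 0, 0; 0, b, -a + 1, 0] := by
  have h : (b - s (a - a ^ 2)) * (b + s (a - a ^ 2)) = 0 := by
    linear_combination hb - hs (a - a ^ 2)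
  rcases mul_eq_zero.1 h with h | h
  · exact .of_eq (.J4 a) trivial (by rw [sub_eq_zero.1 h]; rfl)
  -- At a = 0 and a = 1 the two square roots coincide, which is why `J5` omits these parameters.
  by_cases ha : a - a ^ 2 = 0
  · have h0 : s (a - a ^ 2) = 0 := by
      rw [ha]
      exact pow_eq_zero_iff (two_ne_zero) |>.1 (hs 0)
    exact .of_eq (.J4 a) trivial (by
      rw [show b = s (a - a ^ 2) by rw [h0] at h ⊢; simpa using h]
      rfl)
  · refine .of_eq (.J5 a) ⟨?_, ?_⟩ (by rw [eq_neg_of_add_eq_zero_left h]; rfl)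
    · rintro rfl
      simp at ha
    · rintro rfl
      simp at ha

theorem HasLabel.of_triangular_traceR_one (h2 : (2 : F) ≠ 0) (h5 : (5 : F) ≠ 0)
    (hs : ∀ x : F, s x ^ 2 = x) {a d b c : F} (hac : a + c = 1)
    (hJ : IsJordanAlgebra (MSCAlgebra !![a, 0, 0, 0; d, b, c, 0])) :
    HasLabel s i !![a, 0, 0, 0; d, b, c, 0] := by
  obtain rfl : c = -a + 1 := by linear_combination hac
  obtain ⟨hd, hb⟩ := (isJordanAlgebra_triangular_iff a b _ d).1 hJ
  have h10 : (10 : F) ≠ 0 := by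
    convert mul_ne_zero h2 h5 using 1
    norm_num
  by_cases hb0 : b ^ 2 - a * (-a + 1) = 0
  · have hb' : b ^ 2 = a - a ^ 2 := by linear_combination hb0
    by_cases hd0 : d = 0
    · subst hd0
      exact .of_sq_eq hs hb'
    by_cases hr : b + (-a + 1) - a = 0
    · refine .of_iso (N := !![a, 0, 0, 0; 1, b, -a + 1, 0])
        (algebraIsomorphic_triangular 0 hd0 (by ring)) ?_
      obtain rfl : b = 2 * a - 1 := by linear_combination hr
      -- With b = 2a - 1, the equation b² = a - a² becomes 5a² - 5a + 1 = 0, i.e. (10a - 5)² = 5.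
      have h : (10 * a - 5 - s 5) * (10 * a - 5 + s 5) = 0 := by
        linear_combination 20 * hb' - hs 5
      rcases mul_eq_zero.1 h with h | h
      · have ha : a = 1 / 10 * (5 + s 5) := by field_simp; linear_combination h
        refine .of_eq .J7 trivial ?_
        simp only [JordanLabel.msc]
        rw [show 2 * a - 1 = s 5 / 5 by grind, show -a + 1 = 1 / 10 * (5 - s 5) by grind, ha]
      · have ha : a = 1 / 10 * (5 - s 5) := by field_simp; linear_combination h
        refine .of_eq .J6 trivial ?_
        simp only [JordanLabel.msc]
        rw [show 2 * a - 1 = -(s 5 / 5) by grind, show -a + 1 = 1 / 10 * (5 + s 5) by grind, ha]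
    · exact .of_iso (algebraIsomorphic_triangular (-d / (b + (-a + 1) - a)) one_ne_zero
        (by field_simp; ring)) (.of_sq_eq hs hb')
  · replace hb := (mul_eq_zero.1 hb).resolve_left hb0
    obtain rfl : d = 0 := (mul_eq_zero.1 hd).resolve_right hb0
    obtain rfl : b = -1 + 2 * a := by linear_combination -hb
    -- The two excluded parameters are the roots of 5a² - 5a + 1, where b² = ac would hold as well.
    refine .of_eq (.J3 a) ⟨?_, ?_⟩ rfl
    · rintro rfl
      apply hb0
      field_simp
      linear_combination 5 * hs 5
    · rintro rfl
      apply hb0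
      field_simp
      linear_combination 5 * hs 5

theorem HasLabel.of_triangular_traceR_zero (h2 : (2 : F) ≠ 0) (h3 : (3 : F) ≠ 0)
    (h5 : (5 : F) ≠ 0) (hi : i ^ 2 = -1) {a d b : F} (hab : a + b = 1)
    (hJ : IsJordanAlgebra (MSCAlgebra !![a, 0, 0, 0; d, b, -a, 0])) :
    HasLabel s i !![a, 0, 0, 0; d, b, -a, 0] := by
  obtain rfl : b = 1 - a := by linear_combination hab
  obtain ⟨hd, hb⟩ := (isJordanAlgebra_triangular_iff _ _ _ _).1 hJ
  rcases mul_eq_zero.1 hb with hb | hb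
  · have hr : 1 - a + -a - a ≠ 0 := by
      intro hr
      grind
    refine .of_iso (algebraIsomorphic_triangular (d' := 0) (-d / (1 - a + -a - a)) one_ne_zero
        (by field_simp; ring)) ?_
    -- Here b² = ac means 2a² - 2a + 1 = 0, i.e. (2a - 1)² = -1.
    have h : (2 * a - 1 + i) * (2 * a - 1 - i) = 0 := by linear_combination 2 * hb - hi
    rcases mul_eq_zero.1 h with h | h
    · have ha : a = 1 / 2 - i / 2 := by field_simp; linear_combination h
      refine .of_eq .J9 trivial ?_
      simp only [JordanLabel.msc]
      rw [show 1 - a = 1 / 2 + i / 2 by grind, show -a = -(1 / 2) + i / 2 by grind, ha]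
    · have ha : a = 1 / 2 + i / 2 := by field_simp; linear_combination h
      refine .of_eq .J10 trivial ?_
      simp only [JordanLabel.msc]
      rw [show 1 - a = 1 / 2 - i / 2 by grind, show -a = -(1 / 2) - i / 2 by grind, ha]
  · have ha : a = 1 / 3 := by field_simp; linear_combination hb
    subst ha
    have hne : (1 - 1 / 3 : F) ^ 2 - 1 / 3 * -(1 / 3) ≠ 0 := by
      intro h
      apply h5
      field_simp at h
      grind
    obtain rfl : d = 0 := (mul_eq_zero.1 hd).resolve_right hne
    refine .of_eq .J8 trivial ?_
    simp only [JordanLabel.msc]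
    rw [show (1 - 1 / 3 : F) = 2 / 3 by field_simp; norm_num]

theorem HasLabel.of_traceR_one (h2 : (2 : F) ≠ 0) (h5 : (5 : F) ≠ 0)
    (hs : ∀ x : F, s x ^ 2 = x) {a p q g d b c h : F} (hac : a + c = 1) (hp : p + h = 0)
    (hJ : IsJordanAlgebra (MSCAlgebra !![a, p, q, g; d, b, c, h])) :
    HasLabel s i !![a, p, q, g; d, b, c, h] := by
  obtain rfl : p = -h := by linear_combination hp
  by_cases hg : g = 0
  · subst hg
    have hh : h = 0 := by
      by_contra hh
      -- The scale h⁻¹ makes e₂ idempotent; since p = -h, the shear changes b by 2kh, so this k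
      -- clears b.
      have iso := algebraIsomorphic_shear (a := a) (p := -h) (q := q) (g := 0) (d := d) (b := b)
        (c := c) (h := h) (p' := -1) (g' := 0) (b' := 0) (h' := 1) (-b / (2 * h)) (inv_ne_zero hh)
        rfl (by field_simp; ring) rfl (by ring) rfl (by field_simp; ring) rfl (by field_simp; ring)
      refine not_isJordanAlgebra_of_traceR_one h2 ?_ (iso.isJordanAlgebra hJ)
      linear_combination hac
    subst hh
    rw [neg_zero] at hJ ⊢
    obtain rfl := jordan_of_square_zero_traceR_one h2 hJ
    exact .of_triangular_traceR_one h2 h5 hs hac hJ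
  · have ht : s g⁻¹ ≠ 0 := by
      intro h0
      have := hs g⁻¹
      rw [h0] at this
      simp [hg, eq_comm] at this
    -- Because p = -h, the single choice k = h/g clears both p and h; the scale t satisfies t²g = 1.
    have iso := algebraIsomorphic_shear (a := a) (p := -h) (q := q) (g := g) (d := d) (b := b)
        (c := c) (h := h) (p' := 0) (g' := 1) (h' := 0) (h / g) ht
        rfl (by field_simp; ring) rfl (by rw [hs]; field_simp) rfl rfl rfl (by field_simp; ring)
    have hJ' := iso.isJordanAlgebra hJ
    refine .of_iso iso ?_
    obtain ⟨hq, hd, ha, hc, hb⟩ := jordan_of_square_eq_traceR_one h2 hJ'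
      (by linear_combination hac)
    rw [hq, hd, ha, hc]
    rcases hb with hb | hb
    · exact .of_eq .J1 trivial (by rw [hb]; rfl)
    · exact .of_eq .J2 trivial (by rw [hb]; rfl)

theorem HasLabel.of_traceL_one (h2 : (2 : F) ≠ 0) (h3 : (3 : F) ≠ 0)
    (h5 : (5 : F) ≠ 0) (hs : ∀ x : F, s x ^ 2 = x) (hi : i ^ 2 = -1) {a p q g d b c h : F}
    (hac : a + c = 0) (hp : p + h = 0) (hab : a + b = 1) (hq : q + h = 0)
    (hJ : IsJordanAlgebra (MSCAlgebra !![a, p, q, g; d, b, c, h])) :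
    HasLabel s i !![a, p, q, g; d, b, c, h] := by
  obtain rfl : p = -h := by linear_combination hp
  obtain rfl : q = -h := by linear_combination hq
  obtain rfl : c = -a := by linear_combination hac
  by_cases hg : g = 0
  · subst hg
    obtain rfl := eq_zero_of_isJordanAlgebra_traceR_zero h2 hJ hab
    rw [neg_zero] at hJ ⊢
    exact .of_triangular_traceR_zero h2 h3 h5 hi hab hJ
  · have ht : s g⁻¹ ≠ 0 := by
      intro h0
      have := hs g⁻¹
      rw [h0] at this
      simp [hg, eq_comm] at this
    have iso := algebraIsomorphic_shear (a := a) (p := -h) (q := -h) (g := g) (d := d) (b := b)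
        (c := -a) (h := h) (a' := a - h ^ 2 / g) (c' := -(a - h ^ 2 / g)) (p' := 0) (q' := 0)
        (g' := 1) (h' := 0) (h / g) ht (by field_simp; ring) (by field_simp; ring)
        (by field_simp; ring) (by rw [hs]; field_simp) rfl rfl (by field_simp; ring)
        (by field_simp; ring)
    refine absurd (iso.isJordanAlgebra hJ) (not_isJordanAlgebra_of_square_eq_traceR_zero ?_)
    field_simp
    linear_combination g * hab

/-- The determinant of (u, u²) is a cubic form in u. Where it is nonzero, u and u² form a basis, and
vanishing traces leave only p and g unknown. If it vanished everywhere, the algebra would be zero.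
-/
theorem HasLabel.of_traceless (h2 : (2 : F) ≠ 0) (h3 : (3 : F) ≠ 0)
    {M : Matrix (Fin 2) (Fin 4) F} (hM : M ≠ 0) (hR0 : M 0 0 + M 1 2 = 0)
    (hR1 : M 0 1 + M 1 3 = 0) (hL0 : M 0 0 + M 1 1 = 0) (hL1 : M 0 2 + M 1 3 = 0)
    (hJ : IsJordanAlgebra (MSCAlgebra M)) : HasLabel s i M := by
  have key (x y : F) (hD : x * (M 1 0 * (x * x) + M 1 1 * (x * y) + M 1 2 * (y * x)
      + M 1 3 * (y * y)) - y * (M 0 0 * (x * x) + M 0 1 * (x * y) + M 0 2 * (y * x)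
      + M 0 3 * (y * y)) ≠ 0) : HasLabel s i M := by
    obtain ⟨N, hN⟩ := exists_isBasisChange M hD
    obtain ⟨hr0, hr1⟩ := hN.traceR
    obtain ⟨hl0, hl1⟩ := hN.traceL
    have iso := hN.algebraIsomorphic.symm
    refine .of_iso iso ?_
    replace iso := iso.isJordanAlgebra hJ
    rw [hR0, hR1] at hr0 hr1
    rw [hL0, hL1] at hl0 hl1
    obtain ⟨-, h1, h2', -⟩ := hN
    have hN00 : N 0 0 = 0 := by
      apply mul_left_cancel₀ hD
      linear_combination (M 0 0 * (x * x) + M 0 1 * (x * y) + M 0 2 * (y * x)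
        + M 0 3 * (y * y)) * h2' - (M 1 0 * (x * x) + M 1 1 * (x * y) + M 1 2 * (y * x)
        + M 1 3 * (y * y)) * h1
    have hN10 : N 1 0 = 1 := by
      apply mul_left_cancel₀ hD
      linear_combination y * h1 - x * h2'
    have hNe : N = !![0, N 0 1, N 0 1, N 0 3; 1, 0, 0, -N 0 1] := by
      ext k l
      fin_cases k <;> fin_cases l <;> simp <;> grind
    rw [hNe] at iso
    obtain ⟨h01, h03⟩ := eq_zero_of_isJordanAlgebra_traceless h2 iso
    refine .of_eq .J11 trivial ?_
    rw [hNe, h01, h03]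
    simp [JordanLabel.msc]
  by_contra hne
  -- By tracelessness the cubic form is M₁₀x³ - 3M₀₀x²y + 3M₁₃xy² - M₀₃y³ (indices from 0), so these
  -- four points determine it when 6 ≠ 0.
  have k1 := not_not.1 (mt (key 1 0) hne)
  have k2 := not_not.1 (mt (key 0 1) hne)
  have k3 := not_not.1 (mt (key 1 1) hne)
  have k4 := not_not.1 (mt (key 1 (-1)) hne)
  have h6 : (6 : F) ≠ 0 := by
    convert mul_ne_zero h2 h3 using 1
    norm_num
  have h10 : M 1 0 = 0 := by linear_combination k1
  have h03 : M 0 3 = 0 := by linear_combination -k2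
  have h00 : M 0 0 = 0 := by
    apply mul_left_cancel₀ h6
    grind
  have h13 : M 1 3 = 0 := by
    apply mul_left_cancel₀ h6
    grind
  apply hM
  ext k l
  fin_cases k <;> fin_cases l <;> simp <;> grind

end Existence

/-! ### The listed algebras are Jordan and pairwise non-isomorphic. -/

section Uniqueness

variable {F : Type*} [Field F] {s : F → F} {i : F}

theorem JordanLabel.isJordanAlgebra_msc (h2 : (2 : F) ≠ 0) (h5 : (5 : F) ≠ 0)
    (hs : ∀ x : F, s x ^ 2 = x) (hi : i ^ 2 = -1) (j : JordanLabel F) :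
    IsJordanAlgebra (MSCAlgebra (j.msc s i)) := by
  have h10 : (10 : F) ≠ 0 := by
    convert mul_ne_zero h2 h5 using 1
    norm_num
  have hs5 := hs 5
  rcases j with _ | _ | a | a | a | _ | _ | _ | _ | _ | _
  · refine isJordanAlgebra_iff.2 fun x y z w => Prod.ext ?_ ?_ <;> simp [JordanLabel.msc, mscMul]
      <;> field_simp <;> ring
  · refine isJordanAlgebra_iff.2 fun x y z w => Prod.ext ?_ ?_ <;> simp [JordanLabel.msc, mscMul]
      <;> field_simp <;> ring
  · exact (isJordanAlgebra_triangular_iff _ _ _ _).2 ⟨by ring, by ring⟩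
  · refine (isJordanAlgebra_triangular_iff _ _ _ _).2 ⟨by ring, ?_⟩
    rw [hs]
    ring
  · refine (isJordanAlgebra_triangular_iff _ _ _ _).2 ⟨by ring, ?_⟩
    rw [neg_sq, hs]
    ring
  · exact (isJordanAlgebra_triangular_iff _ _ _ _).2 ⟨by grind, by grind⟩
  · exact (isJordanAlgebra_triangular_iff _ _ _ _).2 ⟨by grind, by grind⟩
  · exact (isJordanAlgebra_triangular_iff _ _ _ _).2 ⟨by ring, by grind⟩
  · exact (isJordanAlgebra_triangular_iff _ _ _ _).2 ⟨by ring, by grind⟩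
  · exact (isJordanAlgebra_triangular_iff _ _ _ _).2 ⟨by ring, by grind⟩
  · exact (isJordanAlgebra_triangular_iff _ _ _ _).2 ⟨by ring, by ring⟩

theorem JordanLabel.msc_eq_zero (j : JordanLabel F) (hj : j ≠ .J11) :
    j.msc s i 0 1 = 0 ∧ j.msc s i 0 2 = 0 ∧ j.msc s i 1 3 = 0 := by
  cases j <;> simp [JordanLabel.msc] at hj ⊢

/-- Records the normalization of the trace forms; J11, where both vanish, is the only exception. -/
theorem JordanLabel.trace_msc (h2 : (2 : F) ≠ 0) (h3 : (3 : F) ≠ 0) (h5 : (5 : F) ≠ 0)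
    (j : JordanLabel F) (hj : j ≠ .J11) :
    j.msc s i 0 0 + j.msc s i 1 2 = 1 ∨
      j.msc s i 0 0 + j.msc s i 1 2 = 0 ∧ j.msc s i 0 0 + j.msc s i 1 1 = 1 := by
  have h10 : (10 : F) ≠ 0 := by
    convert mul_ne_zero h2 h5 using 1
    norm_num
  cases j <;> simp [JordanLabel.msc] at hj ⊢ <;> grind

theorem JordanLabel.msc_ne_zero (h2 : (2 : F) ≠ 0) (h3 : (3 : F) ≠ 0) (h5 : (5 : F) ≠ 0)
    (j : JordanLabel F) : j.msc s i ≠ 0 := by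
  intro h
  by_cases hj : j = .J11
  · subst hj
    simpa [JordanLabel.msc] using congrFun (congrFun h 1) 0
  · simpa [h] using j.trace_msc (s := s) (i := i) h2 h3 h5 hj

/-- Covariance of the trace forms forces x = 1 and z = 0, so the basis change is a shear. It fixes
a, b, c, multiplies the e₂e₂ constant by a nonzero square, and alters d only as a shear does. -/
theorem IsBasisChange.invariants {M N : Matrix (Fin 2) (Fin 4) F} {x y z w : F}
    (h : IsBasisChange M N x y z w) (hM : M 0 1 = 0 ∧ M 0 2 = 0 ∧ M 1 3 = 0)
    (hN : N 0 1 = 0 ∧ N 0 2 = 0 ∧ N 1 3 = 0)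
    (htM : M 0 0 + M 1 2 = 1 ∨ M 0 0 + M 1 2 = 0 ∧ M 0 0 + M 1 1 = 1)
    (htN : N 0 0 + N 1 2 = 1 ∨ N 0 0 + N 1 2 = 0 ∧ N 0 0 + N 1 1 = 1) :
    M 0 0 = N 0 0 ∧ M 1 1 = N 1 1 ∧ M 1 2 = N 1 2 ∧ (M 0 3 = 0 ↔ N 0 3 = 0) ∧
      ∃ k t : F, t ≠ 0 ∧ M 1 0 * t = N 1 0 + k * (N 1 1 + N 1 2 - N 0 0) := by
  obtain ⟨hM1, hM2, hM3⟩ := hM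
  obtain ⟨hN1, hN2, hN3⟩ := hN
  obtain ⟨r1, r2⟩ := h.traceR
  obtain ⟨l1, l2⟩ := h.traceL
  obtain ⟨hD, e1, e2, e3, e4, e5, e6, e7, e8⟩ := h
  simp only [hM1, hM2, hM3, hN1, hN2, hN3] at *
  have hxz : x = 1 ∧ z = 0 := by
    rcases htN with htN | ⟨htN, htN'⟩
    · have hz : z = 0 := by rw [htN] at r2; simpa using r2.symm
      refine ⟨?_, hz⟩
      subst hz
      have hx : x ≠ 0 := by rintro rfl; simp at hD
      rcases htM with htM | ⟨htM, -⟩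
      · rw [htN, htM] at r1; simpa using r1.symm
      · rw [htN, htM] at r1; exact absurd (by simpa using r1.symm) hx
    · rw [htN'] at l1 l2
      rw [htN] at r1
      rcases htM with htM | ⟨-, htM⟩
      · rw [htM] at r1; simp at r1
      · rw [htM] at l1
        exact ⟨by simpa using l1.symm, by simpa using l2.symm⟩
  obtain ⟨rfl, rfl⟩ := hxz
  have hw : w ≠ 0 := by simpa using hD
  have hyg : N 0 3 * y = 0 := by
    apply mul_right_cancel₀ hw
    linear_combination e3
  have ha : M 0 0 = N 0 0 := by linear_combination y * hyg - e1
  refine ⟨ha, ?_, ?_, ?_, y, w, hw, ?_⟩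
  · apply mul_right_cancel₀ hw
    linear_combination -e4
  · apply mul_right_cancel₀ hw
    linear_combination -e6
  · have : M 0 3 = N 0 3 * (w * w) := by linear_combination -e7
    rw [this]
    simp [hw]
  · linear_combination -e2 - y * ha

theorem JordanLabel.eq_of_algebraIsomorphic (h2 : (2 : F) ≠ 0) (h3 : (3 : F) ≠ 0)
    (h5 : (5 : F) ≠ 0) (hs : ∀ x : F, s x ^ 2 = x) (hi : i ^ 2 = -1) {j j' : JordanLabel F}
    (hj : j.Admissible s) (hj' : j'.Admissible s)
    (h : AlgebraIsomorphic F (MSCAlgebra (j.msc s i)) (MSCAlgebra (j'.msc s i))) : j = j' := by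
  have h10 : (10 : F) ≠ 0 := by
    convert mul_ne_zero h2 h5 using 1
    norm_num
  have h11 {l : JordanLabel F} (hl : l ≠ .J11)
      (h : AlgebraIsomorphic F (MSCAlgebra (l.msc s i))
        (MSCAlgebra ((JordanLabel.J11 : JordanLabel F).msc s i))) : False := by
    obtain ⟨x, y, z, w, h⟩ := h.exists_isBasisChange
    have ht := l.trace_msc (s := s) (i := i) h2 h3 h5 hl
    rw [h.traceR.1, h.traceL.1] at ht
    simp [JordanLabel.msc] at ht
  by_cases hJ : j = .J11
  · by_contra hne
    subst hJ
    exact h11 (Ne.symm hne) h.symm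
  by_cases hJ' : j' = .J11
  · subst hJ'
    exact (h11 hJ h).elim
  obtain ⟨x, y, z, w, h⟩ := h.exists_isBasisChange
  obtain ⟨ha, hb, hc, hg, k, t, ht, hd⟩ := h.invariants (j.msc_eq_zero hJ) (j'.msc_eq_zero hJ')
    (j.trace_msc h2 h3 h5 hJ) (j'.trace_msc h2 h3 h5 hJ')
  clear h h11
  have hs5 := hs 5
  have hs0 : s 5 ≠ 0 := by
    intro h0
    rw [h0] at hs5
    exact h5 (by simpa using hs5.symm)
  -- The delicate pairs share a, b, c: J4 and J5 meet only where the root is 0, J3 meets J4 or J5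
  -- only at its excluded parameters, and J6, J7 have b + c = a, so their d cannot become 0.
  rcases j with _ | _ | a | a | a | _ | _ | _ | _ | _ | _ <;>
  rcases j' with _ | _ | a' | a' | a' | _ | _ | _ | _ | _ | _ <;>
  first
  | rfl
  | exact absurd rfl hJ
  | exact absurd rfl hJ'
  | (simp [JordanLabel.msc] at hg; done)
  | (simp only [JordanLabel.msc, JordanLabel.Admissible, Matrix.of_apply, Matrix.cons_val]
      at ha hb hc hd hg hj hj'
     try have q1 := hs (a - a ^ 2)
     try have q2 := hs (a' - a' ^ 2)
     clear hs hJ hJ' hg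
     grind)

end Uniqueness

/-! ### Choice of the adapted basis and conclusion. -/

theorem natCast_ne_zero_of_ringChar_ne {F : Type*} [Field F] {p : ℕ} (hp : p.Prime)
    (h : ringChar F ≠ p) : (p : F) ≠ 0 := by
  intro h0
  rcases (Nat.dvd_prime hp).1 ((ringChar.spec F p).1 h0) with h1 | h1
  · exact CharP.ringChar_ne_one h1
  · exact h h1

theorem HasLabel.of_isJordanAlgebra {F : Type*} [Field F] {s : F → F} {i : F}
    (h2 : (2 : F) ≠ 0) (h3 : (3 : F) ≠ 0) (h5 : (5 : F) ≠ 0) (hs : ∀ x : F, s x ^ 2 = x)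
    (hi : i ^ 2 = -1) {M : Matrix (Fin 2) (Fin 4) F} (hM : M ≠ 0)
    (hJ : IsJordanAlgebra (MSCAlgebra M)) : HasLabel s i M := by
  have exists_dual (r t : F) (h : r ≠ 0 ∨ t ≠ 0) : ∃ x y : F, x * r + y * t = 1 := by
    rcases h with h | h
    · exact ⟨r⁻¹, 0, by simp [h]⟩
    · exact ⟨0, t⁻¹, by simp [h]⟩
  have eta (N : Matrix (Fin 2) (Fin 4) F) :
      N = !![N 0 0, N 0 1, N 0 2, N 0 3; N 1 0, N 1 1, N 1 2, N 1 3] := by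
    ext k l
    fin_cases k <;> fin_cases l <;> rfl
  by_cases hR : M 0 0 + M 1 2 ≠ 0 ∨ M 0 1 + M 1 3 ≠ 0
  · obtain ⟨x, y, hxy⟩ := exists_dual _ _ hR
    -- The second basis vector is the standard kernel vector of the trace form, so the determinant
    -- equals the value of the form on the first vector, which is 1.
    obtain ⟨N, hN⟩ := exists_isBasisChange M (x := x) (y := y) (z := -(M 0 1 + M 1 3))
      (w := M 0 0 + M 1 2) (by rw [mul_neg, sub_neg_eq_add, hxy]; exact one_ne_zero)
    have iso := hN.algebraIsomorphic.symm
    refine .of_iso iso ?_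
    replace iso := iso.isJordanAlgebra hJ
    rw [eta N] at iso ⊢
    refine .of_traceR_one h2 h5 hs ?_ ?_ iso
    · rw [hN.traceR.1, hxy]
    · rw [hN.traceR.2]
      ring
  simp only [ne_eq, not_or, not_not] at hR
  by_cases hL : M 0 0 + M 1 1 ≠ 0 ∨ M 0 2 + M 1 3 ≠ 0
  · obtain ⟨x, y, hxy⟩ := exists_dual _ _ hL
    obtain ⟨N, hN⟩ := exists_isBasisChange M (x := x) (y := y) (z := -(M 0 2 + M 1 3))
      (w := M 0 0 + M 1 1) (by rw [mul_neg, sub_neg_eq_add, hxy]; exact one_ne_zero)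
    have iso := hN.algebraIsomorphic.symm
    refine .of_iso iso ?_
    replace iso := iso.isJordanAlgebra hJ
    rw [eta N] at iso ⊢
    refine .of_traceL_one h2 h3 h5 hs hi ?_ ?_ ?_ ?_ iso
    · rw [hN.traceR.1, hR.1, hR.2]
      ring
    · rw [hN.traceR.2, hR.1, hR.2]
      ring
    · rw [hN.traceL.1, hxy]
    · rw [hN.traceL.2]
      ring
  simp only [ne_eq, not_or, not_not] at hL
  exact .of_traceless h2 h3 hM hR.1 hR.2 hL.1 hL.2 hJ

theorem mainTheorem1 {F : Type*} [Field F] [IsAlgClosed F]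
    (h2 : ringChar F ≠ 2) (h3 : ringChar F ≠ 3) (h5 : ringChar F ≠ 5)
    (s : F → F) (hs : ∀ x : F, s x ^ 2 = x) (i : F) (hi : i ^ 2 = -1) :
    (∀ j : JordanLabel F, j.Admissible s →
      IsJordanAlgebra (MSCAlgebra (j.msc s i)) ∧ IsNontrivialAlgebra (MSCAlgebra (j.msc s i))) ∧
    (∀ (A : Type*) [NonUnitalNonAssocRing A] [Module F A] [IsScalarTower F A A]
      [SMulCommClass F A A], Module.finrank F A = 2 → IsNontrivialAlgebra A → IsJordanAlgebra A →
      ∃! j : JordanLabel F, j.Admissible s ∧ AlgebraIsomorphic F A (MSCAlgebra (j.msc s i))) := by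
  have n2 : (2 : F) ≠ 0 := by exact_mod_cast natCast_ne_zero_of_ringChar_ne Nat.prime_two h2
  have n3 : (3 : F) ≠ 0 := by exact_mod_cast natCast_ne_zero_of_ringChar_ne Nat.prime_three h3
  have n5 : (5 : F) ≠ 0 := by exact_mod_cast natCast_ne_zero_of_ringChar_ne Nat.prime_five h5
  refine ⟨fun j _ => ⟨j.isJordanAlgebra_msc n2 n5 hs hi,
    isNontrivialAlgebra_iff.2 (j.msc_ne_zero n2 n3 n5)⟩, ?_⟩
  intro A _ _ _ _ hdim hnt hJ
  obtain ⟨M, hM⟩ := exists_algebraIsomorphic_MSCAlgebra hdim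
  obtain ⟨j, hj, hMj⟩ := HasLabel.of_isJordanAlgebra (s := s) (i := i) n2 n3 n5 hs hi
    (isNontrivialAlgebra_iff.1 (hM.isNontrivialAlgebra hnt)) (hM.isJordanAlgebra hJ)
  refine ⟨j, ⟨hj, hM.trans hMj⟩, ?_⟩
  rintro j' ⟨hj', hAj'⟩
  exact JordanLabel.eq_of_algebraIsomorphic n2 n3 n5 hs hi hj' hj
    (hAj'.symm.trans (hM.trans hMj))
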